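/- Let $S>0$, $n,m\ge 0$ be integers, $c:\mathbb{R}^n\times\mathbb{R}\to\mathbb{R}$ and $f:\mathbb{R}^n\times\mathbb{R}\to\mathbb{R}^m$ be such that $c(\cdot,t)$ and $f(\cdot,t)$ are twice continuously differentiable for each $t\in[0,S]$, and let $\mathcal{X}(t)\subseteq\mathbb{R}^n$ be closed and convex for each $t\in[0,S]$. Write $\nabla_x c$ for the gradient of $c$ in $x$, $J_{f,x}$ for the Jacobian of $f$ in $x$, $\mathcal{P}_C$ for the Euclidean projection onto $C$, $\mathbb{R}^m_+$ for the nonnegative orthant, and $N_C(x)=\{y:\ y^T(z-x)\le 0\ \ \forall z\in C\}$ for the normal cone of a convex set $C$ at $x\in C$ (with $N_C(x)=\emptyset$ if $x\notin C$). Put $U=\bigcup_{t\in[0,S]}\mathcal{X}(t)$. Assume that (a) for some $\kappa_1\ge 0$, the Hausdorff distance satisfies $d_H(\mathcal{X}(t_1),\mathcal{X}(t_2))\le\kappa_1|t_1-t_2|$ for all $t_1,t_2\in[0,S]$; (b) $\nabla_x c$ is continuous on $U\times[0,S]$, and for some $\kappa_2>0$, $\|\nabla_x c(x,t)\|\le\kappa_2(1+\|x\|)$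 for all $(x,t)\in U\times[0,S]$; (c) $f$ is continuous on $U\times[0,S]$, and $J_{f,x}$ is bounded and continuous on $U\times[0,S]$. Let $\beta,\eta,\epsilon>0$, $\lambda_{\mathrm{prior}}\in\mathbb{R}^m_+$ and $\hat z_0=(\hat x_0,\hat\lambda_0)\in\mathcal{X}(0)\times\mathbb{R}^m_+$. For each integer $T\ge 1$ let $\Delta_T=S/T$, let $\hat z^{(T)}_0=\hat z_0$, and for $\tau=1,\dots,T$ and $t_\tau=\tau\Delta_T$ define $\hat z^{(T)}_\tau=(\hat x^{(T)}_\tau,\hat\lambda^{(T)}_\tau)$ by $$\hat x^{(T)}_\tau=\mathcal{P}_{\mathcal{X}(t_\tau)}\Big[\hat x^{(T)}_{\tau-1}-\beta\Delta_T\Big(\nabla_x c\big(\hat x^{(T)}_{\tau-1},t_\tau\big)+J_{f,x}\big(\hat x^{(T)}_{\tau-1},t_\tau\big)^T\hat\lambda^{(T)}_{\tau-1}\Big)\Big],$$ $$\hat\lambda^{(T)}_\tau=\mathcal{P}_{\mathbb{R}^m_+}\Big[\hat\lambda^{(T)}_{\tau-1}+\eta\beta\Delta_T\Big(f\big(\hat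 x^{(T)}_{\tau-1},t_\tau\big)-\epsilon\big(\hat\lambda^{(T)}_{\tau-1}-\lambda_{\mathrm{prior}}\big)\Big)\Big].$$ Let $\hat z^{(T)}:[0,S]\to\mathbb{R}^n\times\mathbb{R}^m$ be the piecewise linear interpolation $$\hat z^{(T)}(t)=\frac{\tau\Delta_T-t}{\Delta_T}\hat z^{(T)}_{\tau-1}+\frac{t-(\tau-1)\Delta_T}{\Delta_T}\hat z^{(T)}_\tau,\qquad t\in[(\tau-1)\Delta_T,\tau\Delta_T],\ \tau=1,\dots,T.$$ Then, as $T\to\infty$, the sequence $(\hat z^{(T)})_T$ has a subsequence that converges uniformly on $[0,S]$. Moreover, whenever a subsequence of $(\hat z^{(T)})_T$ converges pointwise on $[0,S]$ to some $\hat z=(\hat x,\hat\lambda)$, the convergence is uniform on $[0,S]$, $\hat z$ is Lipschitz continuous on $[0,S]$, and for almost every $t\in[0,S]$ the function $\hat z$ is differentiable at $t$ and $$-\frac{d}{dt}\hat x(t)-\beta\Big(\nabla_x c(\hat x(t),t)+J_{f,x}(\hat x(t),t)^T\hat\lambda(t)\Big)\in N_{\mathcal{X}(t)}(\hat x(t)),$$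 $$-\frac{d}{dt}\hat\lambda(t)+\eta\beta\Big(f(\hat x(t),t)-\epsilon\big(\hat\lambda(t)-\lambda_{\mathrm{prior}}\big)\Big)\in N_{\mathbb{R}^m_+}(\hat\lambda(t)).$$ -/

import Mathlib

open scoped NNReal Topology

noncomputable section

namespace RegPrimalDual

/-- The normal cone `N_C(x) = {y : ⟪y, z - x⟫ ≤ 0 for all z ∈ C}` of a set `C` at a point `x ∈ C`.
It is empty when `x ∉ C`, so that `y ∈ normalCone C x` contains the assertion `x ∈ C`. -/
def normalCone {n : ℕ} (C : Set (EuclideanSpace ℝ (Fin n))) (x : EuclideanSpace ℝ (Fin n)) :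
    Set (EuclideanSpace ℝ (Fin n)) :=
  {y | x ∈ C ∧ ∀ z ∈ C, inner ℝ y (z - x) ≤ 0}

/-- The nonnegative orthant of `ℝ^m`. -/
def nonnegOrthant (m : ℕ) : Set (EuclideanSpace ℝ (Fin m)) :=
  {v | ∀ i, 0 ≤ v i}

open Classical in
/-- The Euclidean projection onto `C`: a point of `C` nearest to `u`. Such a point exists and is
unique when `C` is nonempty, closed and convex (`proj_spec` and `eq_proj` below); if there is
none, the value is `u`. -/
def proj {n : ℕ} (C : Set (EuclideanSpace ℝ (Fin n))) (u : EuclideanSpace ℝ (Fin n)) :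
    EuclideanSpace ℝ (Fin n) :=
  if h : ∃ p ∈ C, ∀ w ∈ C, ‖u - p‖ ≤ ‖u - w‖ then h.choose else u

theorem proj_spec {n : ℕ} {C : Set (EuclideanSpace ℝ (Fin n))} (hne : C.Nonempty)
    (hcl : IsClosed C) (u : EuclideanSpace ℝ (Fin n)) :
    proj C u ∈ C ∧ ∀ w ∈ C, ‖u - proj C u‖ ≤ ‖u - w‖ := by
  have h : ∃ p ∈ C, ∀ w ∈ C, ‖u - p‖ ≤ ‖u - w‖ := by
    obtain ⟨p, hp, hpd⟩ := hcl.exists_infDist_eq_dist hne u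
    refine ⟨p, hp, fun w hw => ?_⟩
    rw [← dist_eq_norm, ← dist_eq_norm, ← hpd]
    exact Metric.infDist_le_dist_of_mem hw
  have e : proj C u = h.choose := dif_pos h
  rw [e]
  exact h.choose_spec

theorem eq_proj {n : ℕ} {C : Set (EuclideanSpace ℝ (Fin n))} (hcl : IsClosed C)
    (hcv : Convex ℝ C) {u p : EuclideanSpace ℝ (Fin n)} (hp : p ∈ C)
    (hmin : ∀ w ∈ C, ‖u - p‖ ≤ ‖u - w‖) : p = proj C u := by
  obtain ⟨hq, hqmin⟩ := proj_spec ⟨p, hp⟩ hcl u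
  set q := proj C u
  have heq : ‖u - p‖ = ‖u - q‖ := le_antisymm (hmin q hq) (hqmin p hp)
  have hmid : (1 / 2 : ℝ) • p + (1 / 2 : ℝ) • q ∈ C :=
    hcv hp hq (by norm_num) (by norm_num) (by norm_num)
  have h1 := hmin _ hmid
  have h2 := parallelogram_law_with_norm ℝ (u - p) (u - q)
  have e1 : u - p + (u - q) = (2 : ℝ) • (u - ((1 / 2 : ℝ) • p + (1 / 2 : ℝ) • q)) := by
    module
  have e2 : u - p - (u - q) = q - p := by abel
  rw [e1, e2, norm_smul, Real.norm_of_nonneg (by norm_num : (0 : ℝ) ≤ 2), ← heq] at h2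
  have h3 : ‖q - p‖ = 0 := by
    nlinarith [norm_nonneg (q - p), norm_nonneg (u - p)]
  exact (sub_eq_zero.mp (norm_eq_zero.mp h3)).symm

/-- The set-valued map `X` is `κ`-Lipschitz on `s` for the (extended) Hausdorff distance. -/
def HausdorffLipschitzOn {n : ℕ} (κ : ℝ≥0) (X : ℝ → Set (EuclideanSpace ℝ (Fin n)))
    (s : Set ℝ) : Prop :=
  ∀ t₁ ∈ s, ∀ t₂ ∈ s, Metric.hausdorffEDist (X t₁) (X t₂) ≤ κ * edist t₁ t₂

/-- The gradient `∇_x c(x, t)`. -/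
def gradX {n : ℕ} (c : EuclideanSpace ℝ (Fin n) → ℝ → ℝ) (x : EuclideanSpace ℝ (Fin n)) (t : ℝ) :
    EuclideanSpace ℝ (Fin n) :=
  gradient (fun y => c y t) x

/-- The Jacobian `J_{f,x}(x, t)`, as a linear map. -/
def jacX {n m : ℕ} (f : EuclideanSpace ℝ (Fin n) → ℝ → EuclideanSpace ℝ (Fin m))
    (x : EuclideanSpace ℝ (Fin n)) (t : ℝ) :
    EuclideanSpace ℝ (Fin n) →L[ℝ] EuclideanSpace ℝ (Fin m) :=
  fderiv ℝ (fun y => f y t) x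

/-- The gradient in `x` of the Lagrangian: `∇_x c(x, t) + J_{f,x}(x, t)ᵀ l`. -/
def primalDir {n m : ℕ} (c : EuclideanSpace ℝ (Fin n) → ℝ → ℝ)
    (f : EuclideanSpace ℝ (Fin n) → ℝ → EuclideanSpace ℝ (Fin m))
    (x : EuclideanSpace ℝ (Fin n)) (l : EuclideanSpace ℝ (Fin m)) (t : ℝ) :
    EuclideanSpace ℝ (Fin n) :=
  gradX c x t + (jacX f x t).adjoint l

/-- The gradient in the multiplier of the regularized Lagrangian: `f(x, t) - ε (l - lprior)`. -/
def dualDir {n m : ℕ} (f : EuclideanSpace ℝ (Fin n) → ℝ → EuclideanSpace ℝ (Fin m))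
    (ε : ℝ) (lprior : EuclideanSpace ℝ (Fin m))
    (x : EuclideanSpace ℝ (Fin n)) (l : EuclideanSpace ℝ (Fin m)) (t : ℝ) :
    EuclideanSpace ℝ (Fin m) :=
  f x t - ε • (l - lprior)

/-- The iterates `(x_τ, l_τ)` of the regularized primal-dual gradient algorithm with sampling
interval `Δ` and step size `α`, started at `z₀`. The data are sampled at the times `τ Δ`. -/
def iterates {n m : ℕ} (c : EuclideanSpace ℝ (Fin n) → ℝ → ℝ)
    (f : EuclideanSpace ℝ (Fin n) → ℝ → EuclideanSpace ℝ (Fin m))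
    (X : ℝ → Set (EuclideanSpace ℝ (Fin n)))
    (η ε : ℝ) (lprior : EuclideanSpace ℝ (Fin m))
    (z₀ : EuclideanSpace ℝ (Fin n) × EuclideanSpace ℝ (Fin m)) (Δ α : ℝ) :
    ℕ → EuclideanSpace ℝ (Fin n) × EuclideanSpace ℝ (Fin m)
  | 0 => z₀
  | τ + 1 =>
    let z := iterates c f X η ε lprior z₀ Δ α τ
    let t : ℝ := ((τ : ℝ) + 1) * Δ
    (proj (X t) (z.1 - α • primalDir c f z.1 z.2 t),
      proj (nonnegOrthant m) (z.2 + (η * α) • dualDir f ε lprior z.1 z.2 t))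

/-- The piecewise linear interpolation of a sequence with mesh `Δ`: on `[(τ - 1) Δ, τ Δ]` with
`τ ≥ 1` it is `((τ Δ - t) / Δ) z_{τ-1} + ((t - (τ - 1) Δ) / Δ) z_τ`, see `interp_eq`. -/
def interp {V : Type*} [AddCommGroup V] [Module ℝ V] (Δ : ℝ) (z : ℕ → V) (t : ℝ) : V :=
  let k : ℕ := ⌈t / Δ⌉₊ - 1
  ((((k : ℝ) + 1) * Δ - t) / Δ) • z k + ((t - (k : ℝ) * Δ) / Δ) • z (k + 1)

theorem interp_eq {V : Type*} [AddCommGroup V] [Module ℝ V] {Δ : ℝ} (hΔ : 0 < Δ) (z : ℕ → V)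
    (k : ℕ) {t : ℝ} (h₁ : (k : ℝ) * Δ ≤ t) (h₂ : t ≤ ((k : ℝ) + 1) * Δ) :
    interp Δ z t =
      ((((k : ℝ) + 1) * Δ - t) / Δ) • z k + ((t - (k : ℝ) * Δ) / Δ) • z (k + 1) := by
  rcases h₁.eq_or_lt with h | h
  · rcases k with _ | j
    · have : t = 0 := by rw [← h]; simp
      subst this
      simp [interp]
    · have e : t / Δ = ((j + 1 : ℕ) : ℝ) := by rw [← h]; field_simp
      have e' : ⌈t / Δ⌉₊ - 1 = j := by rw [e, Nat.ceil_natCast]; rfl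
      simp only [interp, e']
      rw [← h]
      push_cast
      have a1 : ((j + 1 : ℝ) * Δ - (j + 1) * Δ) / Δ = 0 := by simp
      have a2 : ((j + 1 : ℝ) * Δ - j * Δ) / Δ = 1 := by field_simp; ring
      have a3 : ((j + 1 + 1 : ℝ) * Δ - (j + 1) * Δ) / Δ = 1 := by field_simp; ring
      rw [a1, a2, a3]
      simp
  · have e : ⌈t / Δ⌉₊ = k + 1 := by
      rw [Nat.ceil_eq_iff (by omega)]
      push_cast
      refine ⟨?_, ?_⟩
      · simpa using (lt_div_iff₀ hΔ).2 h
      · exact (div_le_iff₀ hΔ).2 h₂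
    simp only [interp, e, Nat.add_sub_cancel]

/-- The trajectory on `[0, S]` obtained with `T` time slots: sampling interval `Δ = S / T`, step
size `α = β Δ`, and linear interpolation of the iterates. -/
def trajectory {n m : ℕ} (c : EuclideanSpace ℝ (Fin n) → ℝ → ℝ)
    (f : EuclideanSpace ℝ (Fin n) → ℝ → EuclideanSpace ℝ (Fin m))
    (X : ℝ → Set (EuclideanSpace ℝ (Fin n)))
    (S β η ε : ℝ) (lprior : EuclideanSpace ℝ (Fin m))
    (z₀ : EuclideanSpace ℝ (Fin n) × EuclideanSpace ℝ (Fin m)) (T : ℕ) :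
    ℝ → EuclideanSpace ℝ (Fin n) × EuclideanSpace ℝ (Fin m) :=
  interp (S / T) (iterates c f X η ε lprior z₀ (S / T) (β * (S / T)))

end RegPrimalDual

end

/-!
The algorithm is a time discretization of a perturbed sweeping process, and the proof is the
classical compactness argument, arranged so that no weak convergence of derivatives is needed.

*Compactness.* A projected step `x ↦ proj C (x - v)` displaces `x` by at most `2 ‖v‖` plus the
distance from `x` to `C` (`norm_proj_sub_sub_le`), and the second term is at most `κ₁ Δ` because
the constraint set moves by that much per slot. The search directions grow at most linearly; for
`f`, which is not assumed to do so, this follows from the bounded Jacobian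
(`exists_norm_le_of_jacX_bdd`). A discrete Grönwall inequality
(`norm_increment_le_of_affine_growth`) then bounds all increments by `L Δ` with `L` independent of
the number of slots. The interpolated trajectories are thus `L`-Lipschitz
(`exists_lipschitzOnWith_trajectory`), Arzelà–Ascoli gives a uniformly convergent subsequence, and
for equi-Lipschitz sequences on a compact interval pointwise convergence is uniform.

*The inclusion.* By Rademacher's theorem a limit `z` is differentiable almost everywhere. The
inclusions hold at every interior point `t` of differentiability. The obtuse-angle property of the
projection (`inner_proj_le`) says
`⟪-(x_τ - x_{τ-1}) - Δ v_τ, w_τ - x_τ⟫ ≤ 0` for `w_τ` in the constraint set at time `τ Δ`. Given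
`w` in the set at time `t`, choose the `w_τ` within `κ₁ |τ Δ - t|` of `w`. For nodes near `t`, the
vectors `w_τ - x_τ` and `v_τ` are then close to `w - x(t)` and to their continuous limit `v`, so
`⟪-(x_τ - x_{τ-1}) - Δ v, w - x(t)⟫ ≤ o(Δ)`. Summation over the nodes in `(t, t + h]`, the limit of
infinitely many slots, and then `h → 0` give `⟪-x'(t) - v, w - x(t)⟫ ≤ 0`
(`inner_deriv_le_of_increments`, `mem_normalCone_of_projected_steps`). The same lemma serves the
multipliers, with the constant set `nonnegOrthant m`.
-/

open Filter Set

namespace RegPrimalDual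

/-! ### Piecewise linear interpolation -/

theorem interp_natCast_mul {V : Type*} [AddCommGroup V] [Module ℝ V] {Δ : ℝ} (hΔ : 0 < Δ)
    (z : ℕ → V) (k : ℕ) : interp Δ z (k * Δ) = z k := by
  rw [interp_eq hΔ z k le_rfl (by nlinarith)]
  have : (((k : ℝ) + 1) * Δ - k * Δ) / Δ = 1 := by field_simp; ring
  simp [this]

theorem lipschitzOnWith_interp {V : Type*} [NormedAddCommGroup V] [NormedSpace ℝ V] {Δ : ℝ}
    (hΔ : 0 < Δ) (z : ℕ → V) (L : ℝ≥0) (T : ℕ)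
    (hz : ∀ k < T, ‖z (k + 1) - z k‖ ≤ L * Δ) :
    LipschitzOnWith L (interp Δ z) (Icc 0 (T * Δ)) := by
  have cell : ∀ k < T, ∀ s t : ℝ, k * Δ ≤ s → s ≤ t → t ≤ (k + 1) * Δ →
      ‖interp Δ z t - interp Δ z s‖ ≤ L * (t - s) := by
    intro k hk s t hs hst ht
    rw [interp_eq hΔ z k (hs.trans hst) ht, interp_eq hΔ z k hs (hst.trans ht)]
    have e : ((((k : ℝ) + 1) * Δ - t) / Δ) • z k + ((t - (k : ℝ) * Δ) / Δ) • z (k + 1) -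
        (((((k : ℝ) + 1) * Δ - s) / Δ) • z k + ((s - (k : ℝ) * Δ) / Δ) • z (k + 1)) =
        ((t - s) / Δ) • (z (k + 1) - z k) := by
      match_scalars <;> field_simp <;> ring
    rw [e, norm_smul, Real.norm_of_nonneg (div_nonneg (sub_nonneg.2 hst) hΔ.le)]
    calc (t - s) / Δ * ‖z (k + 1) - z k‖ ≤ (t - s) / Δ * (L * Δ) :=
          mul_le_mul_of_nonneg_left (hz k hk) (div_nonneg (sub_nonneg.2 hst) hΔ.le)
      _ = L * (t - s) := by field_simp
  have key : ∀ k ≤ T, ∀ s t : ℝ, 0 ≤ s → s ≤ t → t ≤ k * Δ →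
      ‖interp Δ z t - interp Δ z s‖ ≤ L * (t - s) := by
    intro k
    induction k with
    | zero =>
      intro _ s t hs hst ht
      have : s = t := le_antisymm hst (by simp at ht; linarith)
      simp [this]
    | succ k ih =>
      intro hk s t hs hst ht
      push_cast at ht
      rcases le_total t (k * Δ) with h | h
      · exact ih (by omega) s t hs hst h
      rcases le_total (k * Δ) s with h' | h'
      · exact cell k (by omega) s t h' hst ht
      have h1 := ih (by omega) s (k * Δ) hs h' le_rfl
      have h2 := cell k (by omega) (k * Δ) t le_rfl h ht
      have h3 := norm_sub_le_norm_sub_add_norm_sub (interp Δ z t) (interp Δ z (k * Δ))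
        (interp Δ z s)
      linarith
  refine LipschitzOnWith.of_dist_le_mul fun s hs t ht => ?_
  rw [Real.dist_eq]
  rcases le_total s t with h | h
  · rw [dist_comm, dist_eq_norm, abs_sub_comm, abs_of_nonneg (sub_nonneg.2 h)]
    exact key T le_rfl s t hs.1 h ht.2
  · rw [dist_eq_norm, abs_of_nonneg (sub_nonneg.2 h)]
    exact key T le_rfl t s ht.1 h hs.2

/-! ### Equi-Lipschitz sequences of functions on a compact interval -/

section EquiLipschitz

variable {V : Type*} [PseudoMetricSpace V]

/-- Along an equi-Lipschitz sequence, pointwise convergence at `t` upgrades to convergence of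
`Y k s` as `k → ∞` and `s → t` jointly. -/
theorem tendsto_apply_of_equiLipschitz {ι : Type*} {l : Filter ι} {A : Set ℝ} {L : ℝ≥0}
    {Y : ℕ → ℝ → V} {y : V} {t : ℝ} (hY : ∀ᶠ k in atTop, LipschitzOnWith L (Y k) A)
    (ht : t ∈ A) (hlim : Tendsto (fun k => Y k t) atTop (𝓝 y)) {k : ι → ℕ} {s : ι → ℝ}
    (hk : Tendsto k l atTop) (hs : Tendsto s l (𝓝 t)) (hsA : ∀ᶠ i in l, s i ∈ A) :
    Tendsto (fun i => Y (k i) (s i)) l (𝓝 y) := by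
  rw [tendsto_iff_dist_tendsto_zero]
  have h1 : Tendsto (fun i => L * dist (s i) t + dist (Y (k i) t) y) l (𝓝 0) := by
    simpa using ((tendsto_iff_dist_tendsto_zero.1 hs).const_mul (L : ℝ)).add
      (tendsto_iff_dist_tendsto_zero.1 (hlim.comp hk))
  refine squeeze_zero' (Eventually.of_forall fun _ => dist_nonneg) ?_ h1
  filter_upwards [hk.eventually hY, hsA] with i hi hsi
  exact (dist_triangle _ (Y (k i) t) _).trans (by gcongr; exact hi.dist_le_mul _ hsi _ ht)

theorem lipschitzOnWith_of_tendsto {A : Set ℝ} {L : ℝ≥0} {Y : ℕ → ℝ → V} {y : ℝ → V}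
    (hY : ∀ᶠ k in atTop, LipschitzOnWith L (Y k) A)
    (hlim : ∀ t ∈ A, Tendsto (fun k => Y k t) atTop (𝓝 (y t))) : LipschitzOnWith L y A := by
  refine LipschitzOnWith.of_dist_le_mul fun s hs t ht => ?_
  refine le_of_tendsto ((hlim s hs).dist (hlim t ht)) ?_
  filter_upwards [hY] with k hk using hk.dist_le_mul _ hs _ ht

theorem tendstoUniformlyOn_of_equiLipschitz {A : Set ℝ} (hA : IsCompact A) {L : ℝ≥0}
    {Y : ℕ → ℝ → V} {y : ℝ → V} (hY : ∀ᶠ k in atTop, LipschitzOnWith L (Y k) A)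
    (hlim : ∀ t ∈ A, Tendsto (fun k => Y k t) atTop (𝓝 (y t))) :
    TendstoUniformlyOn Y y atTop A := by
  have hy := lipschitzOnWith_of_tendsto hY hlim
  rw [← tendstoLocallyUniformlyOn_iff_tendstoUniformlyOn_of_compact hA,
    tendstoLocallyUniformlyOn_iff_forall_tendsto]
  intro t ht
  have h1 : Tendsto (fun p : ℕ × ℝ => Y p.1 p.2) (atTop ×ˢ 𝓝[A] t) (𝓝 (y t)) :=
    tendsto_apply_of_equiLipschitz hY ht (hlim t ht) tendsto_fst
      (tendsto_snd.mono_right nhdsWithin_le_nhds) (tendsto_snd.eventually self_mem_nhdsWithin)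
  have h2 : Tendsto (fun p : ℕ × ℝ => y p.2) (atTop ×ˢ 𝓝[A] t) (𝓝 (y t)) :=
    (hy.continuousOn t ht).tendsto.comp tendsto_snd
  exact (h2.prodMk_nhds h1).mono_right (nhds_le_uniformity _)

/-- A sequential form of the Arzelà–Ascoli theorem. -/
theorem exists_subseq_tendstoUniformlyOn {V : Type*} [MetricSpace V] [ProperSpace V] {S : ℝ}
    (hS : 0 ≤ S) {L : ℝ≥0} {Y : ℕ → ℝ → V} (hY : ∀ k, LipschitzOnWith L (Y k) (Icc 0 S)) {y₀ : V}
    (hy₀ : ∀ k, Y k 0 = y₀) :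
    ∃ (φ : ℕ → ℕ) (y : ℝ → V), StrictMono φ ∧
      TendstoUniformlyOn (fun k => Y (φ k)) y atTop (Icc 0 S) := by
  have h0 : (0 : ℝ) ∈ Icc 0 S := ⟨le_rfl, hS⟩
  have hlip : ∀ k, LipschitzWith L ((Icc 0 S).domRestrict (Y k)) := fun k => (hY k).to_restrict
  let F : ℕ → BoundedContinuousFunction (Icc 0 S) V := fun k =>
    BoundedContinuousFunction.mkOfCompact ⟨(Icc 0 S).domRestrict (Y k), (hlip k).continuous⟩
  have hcpt : IsCompact (closure (range F)) := by
    refine BoundedContinuousFunction.arzela_ascoli (Metric.closedBall y₀ (L * S))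
      (isCompact_closedBall _ _) _ ?_ ?_
    · rintro _ t ⟨k, rfl⟩
      have h := (hY k).dist_le_mul _ t.2 _ h0
      rw [hy₀ k, Real.dist_eq, sub_zero, abs_of_nonneg t.2.1] at h
      exact h.trans (by gcongr; exact t.2.2)
    · refine (LipschitzWith.uniformEquicontinuous _ L ?_).equicontinuous
      rintro ⟨_, k, rfl⟩
      exact hlip k
  obtain ⟨G, -, φ, hφ, hG⟩ := hcpt.tendsto_subseq fun k => subset_closure (mem_range_self k)
  rw [BoundedContinuousFunction.tendsto_iff_tendstoUniformly] at hG
  refine ⟨φ, fun t => G (projIcc 0 S hS t), hφ, ?_⟩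
  rw [tendstoUniformlyOn_iff_tendstoUniformly_comp_coe]
  have e : (fun t => G (projIcc 0 S hS t)) ∘ ((↑) : Icc 0 S → ℝ) = G := by
    ext t
    simp
  rw [e]
  exact hG

end EquiLipschitz

/-! ### Projections and moving convex sets -/

theorem inner_proj_le {n : ℕ} {C : Set (EuclideanSpace ℝ (Fin n))} (hne : C.Nonempty)
    (hcl : IsClosed C) (hcv : Convex ℝ C) (u : EuclideanSpace ℝ (Fin n))
    {w : EuclideanSpace ℝ (Fin n)} (hw : w ∈ C) : inner ℝ (u - proj C u) (w - proj C u) ≤ 0 := by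
  obtain ⟨hp, hmin⟩ := proj_spec hne hcl u
  have : Nonempty C := ⟨⟨_, hp⟩⟩
  refine (norm_eq_iInf_iff_real_inner_le_zero hcv hp).1 (le_antisymm ?_ ?_) w hw
  · exact le_ciInf fun w => hmin w w.2
  · exact ciInf_le ⟨0, by rintro _ ⟨w, rfl⟩; exact norm_nonneg _⟩ (⟨_, hp⟩ : C)

/-- The displacement of a projected step from a point `x` that need not lie in `C`. Comparing
`proj C (x - v)` with `w` through the minimality of the projection suffices, so `C` need not be
convex. -/
theorem norm_proj_sub_sub_le {n : ℕ} {C : Set (EuclideanSpace ℝ (Fin n))}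
    (hcl : IsClosed C) (x v : EuclideanSpace ℝ (Fin n))
    {w : EuclideanSpace ℝ (Fin n)} (hw : w ∈ C) :
    ‖proj C (x - v) - x‖ ≤ 2 * ‖v‖ + ‖x - w‖ := by
  have h1 := (proj_spec ⟨w, hw⟩ hcl (x - v)).2 w hw
  have h2 : ‖x - v - w‖ ≤ ‖x - w‖ + ‖v‖ := by
    rw [sub_right_comm]; exact norm_sub_le _ _
  have h3 : ‖proj C (x - v) - x‖ ≤ ‖x - v - proj C (x - v)‖ + ‖v‖ := by
    rw [show proj C (x - v) - x = -(x - v - proj C (x - v)) - v by abel]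
    exact (norm_sub_le _ _).trans (by rw [norm_neg])
  linarith

theorem HausdorffLipschitzOn.nonempty {n : ℕ} {κ : ℝ≥0} {C : ℝ → Set (EuclideanSpace ℝ (Fin n))}
    {A : Set ℝ} (hC : HausdorffLipschitzOn κ C A) {s t : ℝ} (hs : s ∈ A) (ht : t ∈ A)
    (hne : (C s).Nonempty) : (C t).Nonempty :=
  Metric.nonempty_of_hausdorffEDist_ne_top hne
    ((hC s hs t ht).trans_lt (ENNReal.mul_lt_top (by simp) (edist_lt_top _ _))).ne

theorem HausdorffLipschitzOn.exists_dist_le {n : ℕ} {κ : ℝ≥0}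
    {C : ℝ → Set (EuclideanSpace ℝ (Fin n))} {A : Set ℝ} (hC : HausdorffLipschitzOn κ C A)
    (hcl : ∀ t ∈ A, IsClosed (C t)) {s t : ℝ} (hs : s ∈ A) (ht : t ∈ A)
    {x : EuclideanSpace ℝ (Fin n)} (hx : x ∈ C s) : ∃ y ∈ C t, dist x y ≤ κ * dist s t := by
  obtain ⟨y, hy, hxy⟩ := (hcl t ht).exists_infDist_eq_dist (hC.nonempty hs ht ⟨x, hx⟩) x
  refine ⟨y, hy, ?_⟩
  rw [← hxy, Metric.infDist]
  refine ENNReal.toReal_le_of_le_ofReal (by positivity) ?_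
  refine (Metric.infEDist_le_hausdorffEDist_of_mem hx).trans ((hC s hs t ht).trans_eq ?_)
  rw [ENNReal.ofReal_mul (by positivity), edist_dist, ENNReal.ofReal_coe_nnreal]

theorem hausdorffLipschitzOn_const {n : ℕ} (C : Set (EuclideanSpace ℝ (Fin n))) (A : Set ℝ) :
    HausdorffLipschitzOn 0 (fun _ => C) A := fun _ _ _ _ => by simp

/-- The union over a compact time set of sets moving Lipschitz-continuously is closed. -/
theorem HausdorffLipschitzOn.isClosed_biUnion {n : ℕ} {κ : ℝ≥0}
    {C : ℝ → Set (EuclideanSpace ℝ (Fin n))} {A : Set ℝ} (hC : HausdorffLipschitzOn κ C A)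
    (hA : IsCompact A) (hcl : ∀ t ∈ A, IsClosed (C t)) : IsClosed (⋃ s ∈ A, C s) := by
  refine IsSeqClosed.isClosed fun x a hx ha => ?_
  simp only [mem_iUnion, exists_prop] at hx
  choose s hsA hxs using hx
  obtain ⟨t, ht, φ, hφ, hst⟩ := hA.tendsto_subseq hsA
  choose y hy hxy using fun k => hC.exists_dist_le hcl (hsA (φ k)) ht (hxs (φ k))
  have h0 : Tendsto (fun k => dist (x (φ k)) (y k)) atTop (𝓝 0) := by
    refine squeeze_zero (fun _ => dist_nonneg) hxy ?_
    simpa using (tendsto_iff_dist_tendsto_zero.1 hst).const_mul (κ : ℝ)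
  have hya : Tendsto y atTop (𝓝 a) :=
    (tendsto_iff_of_dist h0).1 (ha.comp hφ.tendsto_atTop)
  exact mem_biUnion ht ((hcl t ht).mem_of_tendsto hya (Eventually.of_forall hy))

theorem nonempty_nonnegOrthant (m : ℕ) : (nonnegOrthant m).Nonempty := ⟨0, fun _ => le_rfl⟩

theorem isClosed_nonnegOrthant (m : ℕ) : IsClosed (nonnegOrthant m) := by
  simp only [nonnegOrthant, ofPred_forall]
  exact isClosed_iInter fun i => isClosed_le continuous_const (by fun_prop)

theorem convex_nonnegOrthant (m : ℕ) : Convex ℝ (nonnegOrthant m) :=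
  fun x hx y hy a b ha hb _ i => by
    simpa using add_nonneg (mul_nonneg ha (hx i)) (mul_nonneg hb (hy i))

/-! ### The differential inclusion for limits of projected steps -/

/-- The filter on pairs `(k, τ)` along which `k → ∞` and the `τ`-th node `τ Δ_k` of the `k`-th grid
tends to `t`. -/
def nodesNear (Δ : ℕ → ℝ) (t : ℝ) : Filter (ℕ × ℕ) :=
  comap (fun p => (p.1, (p.2 : ℝ) * Δ p.1)) (atTop ×ˢ 𝓝 t)

theorem tendsto_fst_nodesNear (Δ : ℕ → ℝ) (t : ℝ) :
    Tendsto Prod.fst (nodesNear Δ t) atTop :=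
  (tendsto_fst (g := 𝓝 t)).comp tendsto_comap

theorem tendsto_node_nodesNear (Δ : ℕ → ℝ) (t : ℝ) :
    Tendsto (fun p : ℕ × ℕ => (p.2 : ℝ) * Δ p.1) (nodesNear Δ t) (𝓝 t) :=
  (tendsto_snd (f := (atTop : Filter ℕ))).comp tendsto_comap

theorem tendsto_node_succ_nodesNear {Δ : ℕ → ℝ} (hΔ : Tendsto Δ atTop (𝓝 0)) (t : ℝ) :
    Tendsto (fun p : ℕ × ℕ => ((p.2 : ℝ) + 1) * Δ p.1) (nodesNear Δ t) (𝓝 t) := by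
  simpa [add_mul] using (tendsto_node_nodesNear Δ t).add (hΔ.comp (tendsto_fst_nodesNear Δ t))

theorem eventually_nodesNear_iff {Δ : ℕ → ℝ} {t : ℝ} {P : ℕ × ℕ → Prop} :
    (∀ᶠ p in nodesNear Δ t, P p) ↔
      ∃ δ > 0, ∀ᶠ k in atTop, ∀ τ : ℕ, |(τ : ℝ) * Δ k - t| < δ → P (k, τ) := by
  rw [nodesNear, ((atTop_basis.prod Metric.nhds_basis_ball).comap _).eventually_iff]
  simp only [eventually_atTop]
  constructor
  · rintro ⟨⟨N, δ⟩, ⟨-, hδ⟩, h⟩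
    exact ⟨δ, hδ, N, fun k hk τ hτ => h ⟨hk, hτ⟩⟩
  · rintro ⟨δ, hδ, N, h⟩
    exact ⟨⟨N, δ⟩, ⟨trivial, hδ⟩, fun p hp => h p.1 hp.1 p.2 hp.2⟩

theorem tendsto_floor_mul {Δ : ℕ → ℝ} (hpos : ∀ᶠ k in atTop, 0 < Δ k)
    (hΔ : Tendsto Δ atTop (𝓝 0)) {t : ℝ} (ht : 0 ≤ t) :
    Tendsto (fun k => (⌊t / Δ k⌋₊ : ℝ) * Δ k) atTop (𝓝 t) := by
  have h : Tendsto (fun k => t - Δ k) atTop (𝓝 t) := by simpa using tendsto_const_nhds.sub hΔ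
  refine tendsto_of_tendsto_of_tendsto_of_le_of_le' h tendsto_const_nhds ?_ ?_
  · filter_upwards [hpos] with k hk
    have := Nat.lt_floor_add_one (t / Δ k)
    rw [div_lt_iff₀ hk] at this
    linarith
  · filter_upwards [hpos] with k hk
    exact (le_div_iff₀ hk).1 (Nat.floor_le (div_nonneg ht hk.le))

theorem tendsto_floor_nodesNear {Δ : ℕ → ℝ} (hpos : ∀ᶠ k in atTop, 0 < Δ k)
    (hΔ : Tendsto Δ atTop (𝓝 0)) {t : ℝ} (ht : 0 ≤ t) :
    Tendsto (fun k => (k, ⌊t / Δ k⌋₊)) atTop (nodesNear Δ t) :=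
  tendsto_comap_iff.2 (tendsto_id.prodMk (tendsto_floor_mul hpos hΔ ht))

/-- If the increments of `Y k` over the grid cells near `t` satisfy a linear inequality up to an
error that is small relative to the mesh, then the derivative of the limit at `t` satisfies it
exactly. The inequalities are summed over the nodes in `(t, t + h]`; then `k → ∞`, and then
`h → 0`. -/
theorem inner_deriv_le_of_increments {E : Type*} [NormedAddCommGroup E] [InnerProductSpace ℝ E]
    {S t : ℝ} {L : ℝ≥0} {Δ : ℕ → ℝ} {Y : ℕ → ℝ → E} {y : ℝ → E} {y' v q : E}
    (ht : t ∈ Ioo 0 S) (hpos : ∀ᶠ k in atTop, 0 < Δ k) (hΔ : Tendsto Δ atTop (𝓝 0))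
    (hY : ∀ᶠ k in atTop, LipschitzOnWith L (Y k) (Icc 0 S))
    (hlim : ∀ s ∈ Icc 0 S, Tendsto (fun k => Y k s) atTop (𝓝 (y s)))
    (hd : HasDerivAt y y' t)
    (hstep : ∀ e > 0, ∀ᶠ p in nodesNear Δ t,
      inner ℝ (-(Y p.1 ((p.2 + 1) * Δ p.1) - Y p.1 (p.2 * Δ p.1)) - Δ p.1 • v) q ≤ Δ p.1 * e) :
    inner ℝ (-y' - v) q ≤ 0 := by
  refine le_of_forall_pos_le_add fun e he => ?_
  obtain ⟨δ, hδ, hstep⟩ := eventually_nodesNear_iff.1 (hstep e he)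
  have hsum : ∀ᶠ k in atTop, ∀ a b : ℕ, a ≤ b → t - δ < a * Δ k → b * Δ k < t + δ →
      inner ℝ (-(Y k (b * Δ k) - Y k (a * Δ k)) - (b * Δ k - a * Δ k) • v) q
        ≤ (b * Δ k - a * Δ k) * e := by
    filter_upwards [hstep, hpos] with k hk hk0 a b hab ha
    induction b, hab using Nat.le_induction with
    | base => simp
    | succ b hab ih =>
      intro hb
      push_cast at hb ⊢
      have hab' : (a : ℝ) * Δ k ≤ b * Δ k := by gcongr
      have h1 := ih (by linarith)
      have h2 := hk b (abs_lt.2 ⟨by linarith, by linarith⟩)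
      have e1 : -(Y k ((b + 1) * Δ k) - Y k (a * Δ k)) - ((b + 1) * Δ k - a * Δ k) • v =
          (-(Y k (b * Δ k) - Y k (a * Δ k)) - (b * Δ k - a * Δ k) • v) +
          (-(Y k ((b + 1) * Δ k) - Y k (b * Δ k)) - Δ k • v) := by module
      rw [e1, inner_add_left]
      linarith
  have hconv : ∀ s ∈ Ico t S, Tendsto (fun k => Y k (⌊s / Δ k⌋₊ * Δ k)) atTop (𝓝 (y s)) := by
    intro s hs
    have hs0 : 0 < s := ht.1.trans_le hs.1
    have h := tendsto_floor_mul hpos hΔ hs0.le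
    exact tendsto_apply_of_equiLipschitz hY ⟨hs0.le, hs.2.le⟩ (hlim s ⟨hs0.le, hs.2.le⟩)
      tendsto_id h (h.eventually (Icc_mem_nhds hs0 hs.2))
  have hdiff : ∀ h > 0, t + h < S → h < δ →
      inner ℝ (-(y (t + h) - y t) - h • v) q ≤ h * e := by
    intro h h0 hS hhδ
    have ht0 := ht.1.le
    have ct := tendsto_floor_mul hpos hΔ ht0
    have ch := tendsto_floor_mul hpos hΔ (add_nonneg ht0 h0.le)
    have cd := ch.sub ct
    rw [add_sub_cancel_left] at cd
    have c1 := (((hconv (t + h) ⟨by linarith, hS⟩).sub (hconv t ⟨le_rfl, ht.2⟩)).neg.sub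
      (cd.smul_const v)).inner (𝕜 := ℝ) (tendsto_const_nhds (x := q))
    refine le_of_tendsto_of_tendsto c1 (cd.mul_const e) ?_
    filter_upwards [hsum, hpos, ct.eventually (lt_mem_nhds (sub_lt_self t hδ)),
      ch.eventually (gt_mem_nhds (add_lt_add_right hhδ t))] with k hk hk0 h1 h2
    exact hk _ _ (Nat.floor_le_floor (by gcongr; linarith)) h1 h2
  have hslope := ((hd.tendsto_slope_zero_right.neg.sub_const v).inner (𝕜 := ℝ)
    (tendsto_const_nhds (x := q)))
  rw [zero_add]
  refine le_of_tendsto hslope ?_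
  filter_upwards [Ioo_mem_nhdsGT (lt_min (sub_pos.2 ht.2) hδ)] with h hh
  have h1 := hdiff h hh.1 (by linarith [hh.2.trans_le (min_le_left _ _)])
    (hh.2.trans_le (min_le_right _ _))
  have e1 : -(h⁻¹ • (y (t + h) - y t)) - v = h⁻¹ • (-(y (t + h) - y t) - h • v) := by
    have hh0 := hh.1.ne'
    match_scalars <;> field_simp
  rw [e1, real_inner_smul_left, inv_mul_le_iff₀ hh.1]
  exact h1

/-- Limits of projected steps solve a perturbed sweeping process: if the nodal values of `Y k`
arise from steps `-Δ_k v` followed by projection onto `C`, and `v → v'` at the nodes near `t`, then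
the limit `y` satisfies `-y'(t) - v' ∈ N_{C t}(y t)`. -/
theorem mem_normalCone_of_projected_steps {n : ℕ} {C : ℝ → Set (EuclideanSpace ℝ (Fin n))}
    {κ : ℝ≥0} {S t : ℝ} {L : ℝ≥0} {Δ : ℕ → ℝ} {Y : ℕ → ℝ → EuclideanSpace ℝ (Fin n)}
    {y : ℝ → EuclideanSpace ℝ (Fin n)} {y' v' : EuclideanSpace ℝ (Fin n)}
    {v : ℕ × ℕ → EuclideanSpace ℝ (Fin n)}
    (hne : ∀ s ∈ Icc 0 S, (C s).Nonempty) (hcl : ∀ s ∈ Icc 0 S, IsClosed (C s))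
    (hcv : ∀ s ∈ Icc 0 S, Convex ℝ (C s)) (hC : HausdorffLipschitzOn κ C (Icc 0 S))
    (ht : t ∈ Ioo 0 S) (hpos : ∀ᶠ k in atTop, 0 < Δ k) (hΔ : Tendsto Δ atTop (𝓝 0))
    (hY : ∀ᶠ k in atTop, LipschitzOnWith L (Y k) (Icc 0 S))
    (hlim : ∀ s ∈ Icc 0 S, Tendsto (fun k => Y k s) atTop (𝓝 (y s)))
    (hstep : ∀ᶠ p in nodesNear Δ t, Y p.1 ((p.2 + 1) * Δ p.1) =
      proj (C ((p.2 + 1) * Δ p.1)) (Y p.1 (p.2 * Δ p.1) - Δ p.1 • v p))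
    (hv : Tendsto v (nodesNear Δ t) (𝓝 v')) (hd : HasDerivAt y y' t) :
    -y' - v' ∈ normalCone (C t) (y t) := by
  have htI : t ∈ Icc 0 S := Ioo_subset_Icc_self ht
  have hk := tendsto_fst_nodesNear Δ t
  have hn0 := tendsto_node_nodesNear Δ t
  have hn1 := tendsto_node_succ_nodesNear hΔ t
  have hI0 := hn0.eventually (Icc_mem_nhds ht.1 ht.2)
  have hI1 := hn1.eventually (Icc_mem_nhds ht.1 ht.2)
  have hY1 := tendsto_apply_of_equiLipschitz hY htI (hlim t htI) hk hn1 hI1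
  have hdist : Tendsto (fun p : ℕ × ℕ => (κ : ℝ) * dist (((p.2 : ℝ) + 1) * Δ p.1) t)
      (nodesNear Δ t) (𝓝 0) := by
    simpa using (tendsto_iff_dist_tendsto_zero.1 hn1).const_mul (κ : ℝ)
  have : (nodesNear Δ t).NeBot := (tendsto_floor_nodesNear hpos hΔ ht.1.le).neBot
  constructor
  · have : ∀ p : ℕ × ℕ, ∃ w ∈ C t, ((p.2 : ℝ) + 1) * Δ p.1 ∈ Icc 0 S →
        Y p.1 ((p.2 + 1) * Δ p.1) ∈ C ((p.2 + 1) * Δ p.1) →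
        dist (Y p.1 ((p.2 + 1) * Δ p.1)) w ≤ κ * dist (((p.2 : ℝ) + 1) * Δ p.1) t := by
      intro p
      by_cases h : ((p.2 : ℝ) + 1) * Δ p.1 ∈ Icc 0 S ∧
        Y p.1 ((p.2 + 1) * Δ p.1) ∈ C ((p.2 + 1) * Δ p.1)
      · obtain ⟨w, hw, hdw⟩ := hC.exists_dist_le hcl h.1 htI h.2
        exact ⟨w, hw, fun _ _ => hdw⟩
      · obtain ⟨w, hw⟩ := hne t htI
        exact ⟨w, hw, fun h1 h2 => absurd ⟨h1, h2⟩ h⟩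
    choose w hw hdw using this
    have h0 : Tendsto (fun p : ℕ × ℕ => dist (Y p.1 ((p.2 + 1) * Δ p.1)) (w p))
        (nodesNear Δ t) (𝓝 0) := by
      refine squeeze_zero' (Eventually.of_forall fun _ => dist_nonneg) ?_ hdist
      filter_upwards [hI1, hstep] with p hp hs
      refine hdw p hp ?_
      rw [hs]
      exact (proj_spec (hne _ hp) (hcl _ hp) _).1
    exact (hcl t htI).mem_of_tendsto ((tendsto_iff_of_dist h0).1 hY1) (Eventually.of_forall hw)
  · intro w hw
    have : ∀ s : ℝ, ∃ u, s ∈ Icc 0 S → u ∈ C s ∧ dist w u ≤ κ * dist s t := by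
      intro s
      by_cases h : s ∈ Icc 0 S
      · obtain ⟨u, hu, hdu⟩ := hC.exists_dist_le hcl htI h hw
        exact ⟨u, fun _ => ⟨hu, by rwa [dist_comm s]⟩⟩
      · exact ⟨0, fun h' => absurd h' h⟩
    choose u hu using this
    have hu0 : Tendsto (fun p : ℕ × ℕ => u ((p.2 + 1) * Δ p.1)) (nodesNear Δ t) (𝓝 w) := by
      rw [tendsto_iff_dist_tendsto_zero]
      refine squeeze_zero' (Eventually.of_forall fun _ => dist_nonneg) ?_ hdist
      filter_upwards [hI1] with p hp
      rw [dist_comm]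
      exact (hu _ hp).2
    have hq := hu0.sub hY1
    refine inner_deriv_le_of_increments ht hpos hΔ hY hlim hd fun e he => ?_
    -- The difference between the wanted inequality and the obtuse-angle property of the
    -- projection, divided by the mesh, is bounded by a quantity `R` that tends to zero.
    set D : ℕ × ℕ → EuclideanSpace ℝ (Fin n) := fun p =>
      u ((p.2 + 1) * Δ p.1) - Y p.1 ((p.2 + 1) * Δ p.1) with hD
    have hR : Tendsto (fun p => (L : ℝ) * ‖(w - y t) - D p‖ +
        (inner ℝ (v p) (D p) - inner ℝ v' (w - y t))) (nodesNear Δ t) (𝓝 0) := by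
      have h1 := ((tendsto_const_nhds (x := w - y t)).sub hq).norm.const_mul (L : ℝ)
      have h2 := (hv.inner hq).sub_const (inner ℝ v' (w - y t))
      simpa using h1.add h2
    filter_upwards [hR.eventually (gt_mem_nhds he), hI0, hI1, hstep, hk.eventually hY,
      hk.eventually hpos] with p hRp hp0 hp1 hs hYp hΔp
    have hproj := inner_proj_le (hne _ hp1) (hcl _ hp1) (hcv _ hp1)
      (Y p.1 (p.2 * Δ p.1) - Δ p.1 • v p) (hu _ hp1).1
    rw [← hs] at hproj
    change inner ℝ _ (D p) ≤ 0 at hproj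
    have hinc := hYp.dist_le_mul _ hp1 _ hp0
    rw [dist_eq_norm, Real.dist_eq, show ((p.2 : ℝ) + 1) * Δ p.1 - p.2 * Δ p.1 = Δ p.1 by ring,
      abs_of_pos hΔp] at hinc
    set r := Y p.1 ((p.2 + 1) * Δ p.1) - Y p.1 (p.2 * Δ p.1) with hr
    rw [show Y p.1 (p.2 * Δ p.1) - Δ p.1 • v p - Y p.1 ((p.2 + 1) * Δ p.1) =
      -r - Δ p.1 • v p by rw [hr]; abel] at hproj
    have hcs : -inner ℝ r (w - y t - D p) ≤ L * Δ p.1 * ‖w - y t - D p‖ := by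
      rw [← inner_neg_left]
      exact (real_inner_le_norm _ _).trans (by rw [norm_neg]; gcongr)
    simp only [inner_sub_left, inner_sub_right, inner_neg_left, real_inner_smul_left]
      at hproj hcs ⊢
    simp only [inner_sub_right] at hRp
    nlinarith [mul_lt_mul_of_pos_left hRp hΔp]

/-! ### Growth and continuity of the search directions -/

/-- A bounded Jacobian makes `f` grow at most linearly. The union of the sets `X s` need not be
convex, so the mean value inequality is applied inside the single convex set `X s` containing the
point, starting from a point of `X s` that stays in a fixed compact set. -/
theorem exists_norm_le_of_jacX_bdd {n m : ℕ}
    {f : EuclideanSpace ℝ (Fin n) → ℝ → EuclideanSpace ℝ (Fin m)}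
    {X : ℝ → Set (EuclideanSpace ℝ (Fin n))} {S M : ℝ} {κ : ℝ≥0} (hS : 0 ≤ S)
    (hne : (X 0).Nonempty) (hXconvex : ∀ t ∈ Icc 0 S, Convex ℝ (X t))
    (hXclosed : ∀ t ∈ Icc 0 S, IsClosed (X t))
    (hf : ∀ t ∈ Icc 0 S, Differentiable ℝ (fun x => f x t))
    (hXlip : HausdorffLipschitzOn κ X (Icc 0 S))
    (hf_cont : ContinuousOn (fun p : EuclideanSpace ℝ (Fin n) × ℝ => f p.1 p.2)
      ((⋃ s ∈ Icc 0 S, X s) ×ˢ Icc 0 S))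
    (hM : ∀ p ∈ (⋃ s ∈ Icc 0 S, X s) ×ˢ Icc 0 S, ‖jacX f p.1 p.2‖ ≤ M) :
    ∃ K, 0 ≤ K ∧ ∀ p ∈ (⋃ s ∈ Icc 0 S, X s) ×ˢ Icc 0 S, ‖f p.1 p.2‖ ≤ K * (1 + ‖p.1‖) := by
  obtain ⟨x₀, hx₀⟩ := hne
  have h0 : (0 : ℝ) ∈ Icc 0 S := ⟨le_rfl, hS⟩
  set U := ⋃ s ∈ Icc 0 S, X s with hU
  have hUcl : IsClosed U := hXlip.isClosed_biUnion isCompact_Icc hXclosed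
  have hK : IsCompact ((U ∩ Metric.closedBall x₀ (κ * S)) ×ˢ Icc (0 : ℝ) S) :=
    ((isCompact_closedBall _ _).inter_left hUcl).prod isCompact_Icc
  obtain ⟨B, hB⟩ := hK.exists_bound_of_continuousOn
    (hf_cont.mono (prod_mono_left inter_subset_left))
  have hx₀U : x₀ ∈ U := mem_biUnion h0 hx₀
  have hB0 : 0 ≤ B := (norm_nonneg _).trans
    (hB (x₀, 0) ⟨⟨hx₀U, Metric.mem_closedBall_self (by positivity)⟩, h0⟩)
  have hM0 : 0 ≤ M := (norm_nonneg _).trans (hM (x₀, 0) ⟨hx₀U, h0⟩)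
  refine ⟨B + M + M * (‖x₀‖ + κ * S), by positivity, ?_⟩
  rintro ⟨x, t⟩ ⟨hx, ht⟩
  obtain ⟨s, hs, hxs⟩ := mem_iUnion₂.1 hx
  obtain ⟨a, ha, hxa⟩ := hXlip.exists_dist_le hXclosed h0 hs hx₀
  have hxa' : dist x₀ a ≤ κ * S := hxa.trans (by
    rw [dist_comm, Real.dist_eq, sub_zero, abs_of_nonneg hs.1]; gcongr; exact hs.2)
  have hfa := hB (a, t) ⟨⟨mem_biUnion hs ha, by rwa [Metric.mem_closedBall']⟩, ht⟩
  have hmv := (hXconvex s hs).norm_image_sub_le_of_norm_fderiv_le (f := fun x => f x t)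
    (fun y _ => hf t ht y) (fun y hy => hM (y, t) ⟨mem_biUnion hs hy, ht⟩) ha hxs
  have hxa2 : ‖x - a‖ ≤ ‖x‖ + (‖x₀‖ + κ * S) := by
    have h1 : ‖a‖ ≤ ‖x₀‖ + dist x₀ a := by
      rw [dist_comm, dist_eq_norm]; exact norm_le_norm_add_norm_sub' _ _
    have h2 := norm_sub_le x a
    linarith
  have h3 : ‖f x t‖ ≤ ‖f a t‖ + ‖f x t - f a t‖ := norm_le_norm_add_norm_sub' _ _
  have h4 : M * ‖x - a‖ ≤ M * (‖x‖ + (‖x₀‖ + κ * S)) := by gcongr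
  have h5 : 0 ≤ (B + M * (‖x₀‖ + κ * S)) * ‖x‖ := by positivity
  dsimp only at hfa hmv ⊢
  nlinarith

theorem norm_primalDir_le {n m : ℕ} {c : EuclideanSpace ℝ (Fin n) → ℝ → ℝ}
    {f : EuclideanSpace ℝ (Fin n) → ℝ → EuclideanSpace ℝ (Fin m)} {κ M t : ℝ}
    {x : EuclideanSpace ℝ (Fin n)} (l : EuclideanSpace ℝ (Fin m)) (hκ : 0 ≤ κ)
    (hc : ‖gradX c x t‖ ≤ κ * (1 + ‖x‖)) (hM : ‖jacX f x t‖ ≤ M) :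
    ‖primalDir c f x l t‖ ≤ (κ + M) * (1 + ‖(x, l)‖) := by
  have hM0 : 0 ≤ M := (norm_nonneg _).trans hM
  have h1 : ‖(jacX f x t).adjoint l‖ ≤ M * ‖l‖ :=
    ((jacX f x t).adjoint.le_opNorm l).trans (by
      rw [LinearIsometryEquiv.norm_map]; gcongr)
  have hx : ‖x‖ ≤ ‖(x, l)‖ := norm_fst_le (x, l)
  have hl : ‖l‖ ≤ ‖(x, l)‖ := norm_snd_le (x, l)
  have h2 : ‖primalDir c f x l t‖ ≤ _ := norm_add_le _ _
  have h3 : κ * (1 + ‖x‖) ≤ κ * (1 + ‖(x, l)‖) := by gcongr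
  have h4 : M * ‖l‖ ≤ M * ‖(x, l)‖ := by gcongr
  linarith

theorem norm_dualDir_le {n m : ℕ}
    {f : EuclideanSpace ℝ (Fin n) → ℝ → EuclideanSpace ℝ (Fin m)} {K ε t : ℝ}
    {x : EuclideanSpace ℝ (Fin n)} (l lprior : EuclideanSpace ℝ (Fin m)) (hK : 0 ≤ K)
    (hε : 0 ≤ ε) (hf : ‖f x t‖ ≤ K * (1 + ‖x‖)) :
    ‖dualDir f ε lprior x l t‖ ≤ (K + ε * (1 + ‖lprior‖)) * (1 + ‖(x, l)‖) := by
  have hx : ‖x‖ ≤ ‖(x, l)‖ := norm_fst_le (x, l)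
  have hl : ‖l‖ ≤ ‖(x, l)‖ := norm_snd_le (x, l)
  have h1 : ‖ε • (l - lprior)‖ ≤ ε * (‖l‖ + ‖lprior‖) := by
    rw [norm_smul, Real.norm_of_nonneg hε]
    gcongr
    exact norm_sub_le _ _
  have h2 : ‖dualDir f ε lprior x l t‖ ≤ _ := norm_sub_le _ _
  have h3 : K * (1 + ‖x‖) ≤ K * (1 + ‖(x, l)‖) := by gcongr
  have h4 : ε * (‖l‖ + ‖lprior‖) ≤ ε * ((1 + ‖lprior‖) * (1 + ‖(x, l)‖)) := by
    gcongr
    nlinarith [norm_nonneg lprior, norm_nonneg (x, l)]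
  linarith

theorem continuousOn_primalDir {n m : ℕ} {c : EuclideanSpace ℝ (Fin n) → ℝ → ℝ}
    {f : EuclideanSpace ℝ (Fin n) → ℝ → EuclideanSpace ℝ (Fin m)}
    {U : Set (EuclideanSpace ℝ (Fin n))} {I : Set ℝ}
    (hc : ContinuousOn (fun p : EuclideanSpace ℝ (Fin n) × ℝ => gradX c p.1 p.2) (U ×ˢ I))
    (hf : ContinuousOn (fun p : EuclideanSpace ℝ (Fin n) × ℝ => jacX f p.1 p.2) (U ×ˢ I)) :
    ContinuousOn (fun p : (EuclideanSpace ℝ (Fin n) × EuclideanSpace ℝ (Fin m)) × ℝ =>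
      primalDir c f p.1.1 p.1.2 p.2) ((U ×ˢ univ) ×ˢ I) := by
  have hmap : MapsTo (fun p : (EuclideanSpace ℝ (Fin n) × EuclideanSpace ℝ (Fin m)) × ℝ =>
      (p.1.1, p.2)) ((U ×ˢ univ) ×ˢ I) (U ×ˢ I) := fun p hp => ⟨hp.1.1, hp.2⟩
  have hcont : ContinuousOn (fun p : (EuclideanSpace ℝ (Fin n) × EuclideanSpace ℝ (Fin m)) × ℝ =>
      (p.1.1, p.2)) ((U ×ˢ univ) ×ˢ I) := by fun_prop
  have h1 := hc.comp hcont hmap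
  have h2 := (ContinuousLinearMap.adjoint (𝕜 := ℝ) (E := EuclideanSpace ℝ (Fin n))
    (F := EuclideanSpace ℝ (Fin m))).continuous.comp_continuousOn (hf.comp hcont hmap)
  exact h1.add (h2.clm_apply (by fun_prop))

theorem continuousOn_dualDir {n m : ℕ}
    {f : EuclideanSpace ℝ (Fin n) → ℝ → EuclideanSpace ℝ (Fin m)}
    {U : Set (EuclideanSpace ℝ (Fin n))} {I : Set ℝ} (ε : ℝ) (lprior : EuclideanSpace ℝ (Fin m))
    (hf : ContinuousOn (fun p : EuclideanSpace ℝ (Fin n) × ℝ => f p.1 p.2) (U ×ˢ I)) :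
    ContinuousOn (fun p : (EuclideanSpace ℝ (Fin n) × EuclideanSpace ℝ (Fin m)) × ℝ =>
      dualDir f ε lprior p.1.1 p.1.2 p.2) ((U ×ˢ univ) ×ˢ I) := by
  have hcont : ContinuousOn (fun p : (EuclideanSpace ℝ (Fin n) × EuclideanSpace ℝ (Fin m)) × ℝ =>
      (p.1.1, p.2)) ((U ×ˢ univ) ×ˢ I) := by fun_prop
  exact (hf.comp hcont fun p hp => ⟨hp.1.1, hp.2⟩).sub (by fun_prop)

/-! ### A priori bounds for the iterates -/

theorem iterates_succ {n m : ℕ} (c : EuclideanSpace ℝ (Fin n) → ℝ → ℝ)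
    (f : EuclideanSpace ℝ (Fin n) → ℝ → EuclideanSpace ℝ (Fin m))
    (X : ℝ → Set (EuclideanSpace ℝ (Fin n))) (η ε : ℝ) (lprior : EuclideanSpace ℝ (Fin m))
    (z₀ : EuclideanSpace ℝ (Fin n) × EuclideanSpace ℝ (Fin m)) (Δ α : ℝ) (τ : ℕ) :
    iterates c f X η ε lprior z₀ Δ α (τ + 1) =
      (proj (X ((τ + 1) * Δ)) ((iterates c f X η ε lprior z₀ Δ α τ).1 -
        α • primalDir c f (iterates c f X η ε lprior z₀ Δ α τ).1
          (iterates c f X η ε lprior z₀ Δ α τ).2 ((τ + 1) * Δ)),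
      proj (nonnegOrthant m) ((iterates c f X η ε lprior z₀ Δ α τ).2 +
        (η * α) • dualDir f ε lprior (iterates c f X η ε lprior z₀ Δ α τ).1
          (iterates c f X η ε lprior z₀ Δ α τ).2 ((τ + 1) * Δ))) := rfl

theorem iterates_mem {n m : ℕ} {c : EuclideanSpace ℝ (Fin n) → ℝ → ℝ}
    {f : EuclideanSpace ℝ (Fin n) → ℝ → EuclideanSpace ℝ (Fin m)}
    {X : ℝ → Set (EuclideanSpace ℝ (Fin n))} {S η ε : ℝ} {lprior : EuclideanSpace ℝ (Fin m)}
    {z₀ : EuclideanSpace ℝ (Fin n) × EuclideanSpace ℝ (Fin m)} {Δ α : ℝ} (hΔ : 0 ≤ Δ)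
    (hne : ∀ t ∈ Icc 0 S, (X t).Nonempty) (hcl : ∀ t ∈ Icc 0 S, IsClosed (X t))
    (hz₀ : z₀ ∈ X 0 ×ˢ nonnegOrthant m) (τ : ℕ) (hτ : τ * Δ ≤ S) :
    iterates c f X η ε lprior z₀ Δ α τ ∈ X (τ * Δ) ×ˢ nonnegOrthant m := by
  cases τ with
  | zero => simpa [iterates] using hz₀
  | succ τ =>
    have hI : ((τ + 1 : ℕ) : ℝ) * Δ ∈ Icc 0 S := ⟨by positivity, hτ⟩
    rw [iterates_succ]
    push_cast at hI ⊢
    exact ⟨(proj_spec (hne _ hI) (hcl _ hI) _).1,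
      (proj_spec (nonempty_nonnegOrthant m) (isClosed_nonnegOrthant m) _).1⟩

/-- A discrete Grönwall inequality: increments of size `K Δ (1 + ‖z τ‖)` are of size `O(Δ)` up to
time `T Δ = S`. -/
theorem norm_increment_le_of_affine_growth {V : Type*} [SeminormedAddCommGroup V] {z : ℕ → V}
    {K Δ S : ℝ} {T : ℕ} (hK : 0 ≤ K) (hΔ : 0 ≤ Δ) (hT : T * Δ ≤ S)
    (hz : ∀ τ < T, ‖z (τ + 1) - z τ‖ ≤ K * Δ * (1 + ‖z τ‖)) :
    ∀ τ < T, ‖z (τ + 1) - z τ‖ ≤ K * (Real.exp (K * S) * (1 + ‖z 0‖)) * Δ := by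
  have hb : ∀ τ ≤ T, 1 + ‖z τ‖ ≤ Real.exp (K * (τ * Δ)) * (1 + ‖z 0‖) := by
    intro τ
    induction τ with
    | zero => simp
    | succ τ ih =>
      intro hτ
      have h1 := ih (by omega)
      have h2 := hz τ hτ
      have h3 : ‖z (τ + 1)‖ ≤ ‖z τ‖ + ‖z (τ + 1) - z τ‖ := norm_le_norm_add_norm_sub' _ _
      calc 1 + ‖z (τ + 1)‖ ≤ (K * Δ + 1) * (1 + ‖z τ‖) := by linarith
        _ ≤ Real.exp (K * Δ) * (Real.exp (K * (τ * Δ)) * (1 + ‖z 0‖)) := by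
          gcongr
          exact Real.add_one_le_exp _
        _ = Real.exp (K * ((τ + 1 : ℕ) * Δ)) * (1 + ‖z 0‖) := by
          rw [← mul_assoc, ← Real.exp_add]; push_cast; ring_nf
  intro τ hτ
  calc ‖z (τ + 1) - z τ‖ ≤ K * Δ * (1 + ‖z τ‖) := hz τ hτ
    _ ≤ K * Δ * (Real.exp (K * S) * (1 + ‖z 0‖)) := by
      gcongr
      refine (hb τ hτ.le).trans ?_
      gcongr
      exact (by gcongr : (τ : ℝ) * Δ ≤ T * Δ).trans hT
    _ = _ := by ring

/-- The trajectories are Lipschitz with a constant that does not depend on the number of slots. -/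
theorem exists_lipschitzOnWith_trajectory {n m : ℕ} {c : EuclideanSpace ℝ (Fin n) → ℝ → ℝ}
    {f : EuclideanSpace ℝ (Fin n) → ℝ → EuclideanSpace ℝ (Fin m)}
    {X : ℝ → Set (EuclideanSpace ℝ (Fin n))} {S β η ε κ₂ M K : ℝ} {κ₁ : ℝ≥0}
    {lprior : EuclideanSpace ℝ (Fin m)}
    {z₀ : EuclideanSpace ℝ (Fin n) × EuclideanSpace ℝ (Fin m)}
    (hS : 0 < S) (hβ : 0 ≤ β) (hη : 0 ≤ η) (hε : 0 ≤ ε) (hκ₂ : 0 ≤ κ₂) (hM0 : 0 ≤ M) (hK : 0 ≤ K)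
    (hz₀ : z₀ ∈ X 0 ×ˢ nonnegOrthant m) (hXclosed : ∀ t ∈ Icc 0 S, IsClosed (X t))
    (hXlip : HausdorffLipschitzOn κ₁ X (Icc 0 S))
    (hgrad : ∀ p ∈ (⋃ s ∈ Icc 0 S, X s) ×ˢ Icc 0 S, ‖gradX c p.1 p.2‖ ≤ κ₂ * (1 + ‖p.1‖))
    (hM : ∀ p ∈ (⋃ s ∈ Icc 0 S, X s) ×ˢ Icc 0 S, ‖jacX f p.1 p.2‖ ≤ M)
    (hf : ∀ p ∈ (⋃ s ∈ Icc 0 S, X s) ×ˢ Icc 0 S, ‖f p.1 p.2‖ ≤ K * (1 + ‖p.1‖)) :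
    ∃ L : ℝ≥0, ∀ T : ℕ, 0 < T →
      LipschitzOnWith L (trajectory c f X S β η ε lprior z₀ T) (Icc 0 S) := by
  have hne : ∀ t ∈ Icc 0 S, (X t).Nonempty := fun t ht =>
    hXlip.nonempty ⟨le_rfl, hS.le⟩ ht ⟨_, hz₀.1⟩
  set K₁ := κ₂ + M
  set K₂ := K + ε * (1 + ‖lprior‖)
  have hK₁ : 0 ≤ K₁ := by positivity
  have hK₂ : 0 ≤ K₂ := by positivity
  set G := 2 * β * K₁ + κ₁ + 2 * (η * β * K₂)
  have hG : 0 ≤ G := by positivity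
  refine ⟨⟨G * (Real.exp (G * S) * (1 + ‖z₀‖)), by positivity⟩, fun T hT => ?_⟩
  have hT' : (0 : ℝ) < T := by exact_mod_cast hT
  have hΔ : 0 < S / T := by positivity
  have hTS : T * (S / T) = S := by field_simp
  rw [trajectory]
  conv => arg 3; rw [← hTS]
  refine lipschitzOnWith_interp hΔ _ _ T
    (norm_increment_le_of_affine_growth hG hΔ.le hTS.le fun τ hτ => ?_)
  set Δ := S / (T : ℝ)
  have hτ0 : (τ : ℝ) * Δ ∈ Icc 0 S :=
    ⟨by positivity, hTS ▸ by gcongr⟩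
  have hτ1 : ((τ : ℝ) + 1) * Δ ∈ Icc 0 S :=
    ⟨by positivity, hTS ▸ by gcongr; exact_mod_cast hτ⟩
  have hmem := iterates_mem (c := c) (f := f) (η := η) (ε := ε) (lprior := lprior) (α := β * Δ)
    hΔ.le hne hXclosed hz₀ τ hτ0.2
  rw [iterates_succ]
  set z := iterates c f X η ε lprior z₀ Δ (β * Δ) τ
  have hU : (z.1, ((τ : ℝ) + 1) * Δ) ∈ (⋃ s ∈ Icc 0 S, X s) ×ˢ Icc 0 S :=
    ⟨mem_biUnion hτ0 hmem.1, hτ1⟩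
  obtain ⟨w, hw, hdw⟩ := hXlip.exists_dist_le hXclosed hτ0 hτ1 hmem.1
  rw [dist_eq_norm, Real.dist_eq, show (τ : ℝ) * Δ - (τ + 1) * Δ = -Δ by ring, abs_neg,
    abs_of_pos hΔ] at hdw
  have h1 := norm_primalDir_le z.2 hκ₂ (hgrad _ hU) (hM _ hU)
  have h2 := norm_dualDir_le z.2 lprior hK hε (hf _ hU)
  dsimp only at h1 h2
  have h3 := norm_proj_sub_sub_le (hXclosed _ hτ1) z.1
    ((β * Δ) • primalDir c f z.1 z.2 ((τ + 1) * Δ)) hw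
  have h4 := norm_proj_sub_sub_le (isClosed_nonnegOrthant m) z.2
    (-((η * (β * Δ)) • dualDir f ε lprior z.1 z.2 ((τ + 1) * Δ))) hmem.2
  rw [sub_neg_eq_add, norm_neg, sub_self, norm_zero, norm_smul,
    Real.norm_of_nonneg (by positivity)] at h4
  rw [norm_smul, Real.norm_of_nonneg (by positivity)] at h3
  have hz1 : (1 : ℝ) ≤ 1 + ‖z‖ := by linarith [norm_nonneg z]
  have h5 : κ₁ * Δ ≤ κ₁ * Δ * (1 + ‖z‖) := le_mul_of_one_le_right (by positivity) hz1
  have h6 : β * Δ * ‖primalDir c f z.1 z.2 ((τ + 1) * Δ)‖ ≤ β * Δ * (K₁ * (1 + ‖z‖)) := by gcongr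
  have h7 : η * (β * Δ) * ‖dualDir f ε lprior z.1 z.2 ((τ + 1) * Δ)‖ ≤
    η * (β * Δ) * (K₂ * (1 + ‖z‖)) := by gcongr
  have h8 : 0 ≤ β * Δ * (K₁ * (1 + ‖z‖)) := by positivity
  have h9 : 0 ≤ η * (β * Δ) * (K₂ * (1 + ‖z‖)) := by positivity
  have h10 : 0 ≤ κ₁ * Δ * (1 + ‖z‖) := by positivity
  have hG' : G * Δ * (1 + ‖z‖) = 2 * (β * Δ * (K₁ * (1 + ‖z‖))) + κ₁ * Δ * (1 + ‖z‖) +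
    2 * (η * (β * Δ) * (K₂ * (1 + ‖z‖))) := by ring
  rw [hG', Prod.norm_def]
  exact max_le (by dsimp only [Prod.fst_sub]; linarith) (by dsimp only [Prod.snd_sub]; linarith)

theorem trajectory_node {n m : ℕ} (c : EuclideanSpace ℝ (Fin n) → ℝ → ℝ)
    (f : EuclideanSpace ℝ (Fin n) → ℝ → EuclideanSpace ℝ (Fin m))
    (X : ℝ → Set (EuclideanSpace ℝ (Fin n))) {S : ℝ} (β η ε : ℝ)
    (lprior : EuclideanSpace ℝ (Fin m))
    (z₀ : EuclideanSpace ℝ (Fin n) × EuclideanSpace ℝ (Fin m)) {T : ℕ} (hΔ : 0 < S / T) (τ : ℕ) :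
    trajectory c f X S β η ε lprior z₀ T (τ * (S / T)) =
      iterates c f X η ε lprior z₀ (S / T) (β * (S / T)) τ :=
  interp_natCast_mul hΔ _ τ

/-! ### Limits of the trajectories -/

/-- At every interior point of differentiability, a limit of equi-Lipschitz trajectories satisfies
both normal cone inclusions. -/
theorem normalCone_inclusions_of_tendsto {n m : ℕ} {c : EuclideanSpace ℝ (Fin n) → ℝ → ℝ}
    {f : EuclideanSpace ℝ (Fin n) → ℝ → EuclideanSpace ℝ (Fin m)}
    {X : ℝ → Set (EuclideanSpace ℝ (Fin n))} {S β η ε t : ℝ} {κ₁ L : ℝ≥0}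
    {lprior : EuclideanSpace ℝ (Fin m)}
    {z₀ : EuclideanSpace ℝ (Fin n) × EuclideanSpace ℝ (Fin m)}
    (hS : 0 < S) (hz₀ : z₀ ∈ X 0 ×ˢ nonnegOrthant m)
    (hXconvex : ∀ t ∈ Icc 0 S, Convex ℝ (X t)) (hXclosed : ∀ t ∈ Icc 0 S, IsClosed (X t))
    (hXlip : HausdorffLipschitzOn κ₁ X (Icc 0 S))
    (hgrad_cont : ContinuousOn (fun p : EuclideanSpace ℝ (Fin n) × ℝ => gradX c p.1 p.2)
      ((⋃ s ∈ Icc 0 S, X s) ×ˢ Icc 0 S))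
    (hf_cont : ContinuousOn (fun p : EuclideanSpace ℝ (Fin n) × ℝ => f p.1 p.2)
      ((⋃ s ∈ Icc 0 S, X s) ×ˢ Icc 0 S))
    (hjac_cont : ContinuousOn (fun p : EuclideanSpace ℝ (Fin n) × ℝ => jacX f p.1 p.2)
      ((⋃ s ∈ Icc 0 S, X s) ×ˢ Icc 0 S))
    {φ : ℕ → ℕ} (hφ : StrictMono φ)
    {z : ℝ → EuclideanSpace ℝ (Fin n) × EuclideanSpace ℝ (Fin m)}
    (hlip : ∀ᶠ k in atTop,
      LipschitzOnWith L (trajectory c f X S β η ε lprior z₀ (φ k)) (Icc 0 S))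
    (hlim : ∀ t ∈ Icc 0 S,
      Tendsto (fun k => trajectory c f X S β η ε lprior z₀ (φ k) t) atTop (𝓝 (z t)))
    (ht : t ∈ Ioo 0 S) {x' : EuclideanSpace ℝ (Fin n)} {l' : EuclideanSpace ℝ (Fin m)}
    (hx' : HasDerivAt (fun s => (z s).1) x' t) (hl' : HasDerivAt (fun s => (z s).2) l' t) :
    -x' - β • primalDir c f (z t).1 (z t).2 t ∈ normalCone (X t) (z t).1 ∧
      -l' + (η * β) • dualDir f ε lprior (z t).1 (z t).2 t
        ∈ normalCone (nonnegOrthant m) (z t).2 := by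
  have htI : t ∈ Icc 0 S := Ioo_subset_Icc_self ht
  have hne : ∀ t ∈ Icc 0 S, (X t).Nonempty := fun t ht =>
    hXlip.nonempty ⟨le_rfl, hS.le⟩ ht ⟨_, hz₀.1⟩
  set Δ : ℕ → ℝ := fun k => S / (φ k : ℝ) with hΔdef
  set Y : ℕ → ℝ → EuclideanSpace ℝ (Fin n) × EuclideanSpace ℝ (Fin m) :=
    fun k => trajectory c f X S β η ε lprior z₀ (φ k) with hYdef
  have hΔ : Tendsto Δ atTop (𝓝 0) :=
    (tendsto_const_div_atTop_nhds_zero_nat S).comp hφ.tendsto_atTop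
  have hpos : ∀ᶠ k in atTop, 0 < Δ k := by
    filter_upwards [hφ.tendsto_atTop.eventually (eventually_gt_atTop 0)] with k hk
    have : (0 : ℝ) < φ k := by exact_mod_cast hk
    exact div_pos hS this
  have hk := tendsto_fst_nodesNear Δ t
  have hn0 := tendsto_node_nodesNear Δ t
  have hn1 := tendsto_node_succ_nodesNear hΔ t
  have hI0 := hn0.eventually (Icc_mem_nhds ht.1 ht.2)
  have hI1 := hn1.eventually (Icc_mem_nhds ht.1 ht.2)
  have : (nodesNear Δ t).NeBot := (tendsto_floor_nodesNear hpos hΔ ht.1.le).neBot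
  -- The steps of the algorithm, read off from the nodal values of the trajectories.
  have hstep : ∀ᶠ p in nodesNear Δ t, Y p.1 ((p.2 + 1) * Δ p.1) =
      (proj (X ((p.2 + 1) * Δ p.1)) ((Y p.1 (p.2 * Δ p.1)).1 - Δ p.1 •
        β • primalDir c f (Y p.1 (p.2 * Δ p.1)).1 (Y p.1 (p.2 * Δ p.1)).2 ((p.2 + 1) * Δ p.1)),
      proj (nonnegOrthant m) ((Y p.1 (p.2 * Δ p.1)).2 - Δ p.1 •
        (-((η * β) • dualDir f ε lprior (Y p.1 (p.2 * Δ p.1)).1 (Y p.1 (p.2 * Δ p.1)).2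
          ((p.2 + 1) * Δ p.1))))) := by
    filter_upwards [hk.eventually hpos] with p hp
    have h0 := trajectory_node c f X β η ε lprior z₀ hp p.2
    have h1 := trajectory_node c f X β η ε lprior z₀ hp (p.2 + 1)
    push_cast at h1
    simp only [hYdef, hΔdef]
    rw [h0, h1, iterates_succ, smul_neg, sub_neg_eq_add, smul_smul, smul_smul,
      mul_comm _ β, mul_comm _ (η * β), mul_assoc η]
  set U := ⋃ s ∈ Icc 0 S, X s with hU
  have hYU : ∀ᶠ p in nodesNear Δ t, (Y p.1 (p.2 * Δ p.1)).1 ∈ U := by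
    filter_upwards [hI0, hk.eventually hpos] with p hp hΔp
    have hmem := iterates_mem (c := c) (f := f) (η := η) (ε := ε) (lprior := lprior)
      (α := β * Δ p.1) hΔp.le hne hXclosed hz₀ p.2 hp.2
    rw [← trajectory_node c f X β η ε lprior z₀ hΔp p.2] at hmem
    exact mem_biUnion hp hmem.1
  have hY0 : Tendsto (fun p : ℕ × ℕ => Y p.1 (p.2 * Δ p.1)) (nodesNear Δ t) (𝓝 (z t)) :=
    tendsto_apply_of_equiLipschitz hlip htI (hlim t htI) hk hn0 hI0
  have hztU : (z t).1 ∈ U :=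
    (hXlip.isClosed_biUnion isCompact_Icc hXclosed).mem_of_tendsto hY0.fst_nhds hYU
  have hdom : Tendsto (fun p : ℕ × ℕ => (Y p.1 (p.2 * Δ p.1), ((p.2 : ℝ) + 1) * Δ p.1))
      (nodesNear Δ t) (𝓝[(U ×ˢ univ) ×ˢ Icc 0 S] (z t, t)) := by
    refine tendsto_nhdsWithin_iff.2 ⟨hY0.prodMk_nhds hn1, ?_⟩
    filter_upwards [hYU, hI1] with p hp hp1 using ⟨⟨hp, trivial⟩, hp1⟩
  have hzt : (z t, t) ∈ (U ×ˢ univ) ×ˢ Icc 0 S := ⟨⟨hztU, trivial⟩, htI⟩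
  have hprimal := (continuousOn_primalDir hgrad_cont hjac_cont _ hzt).tendsto.comp hdom
  have hdual := (continuousOn_dualDir ε lprior hf_cont _ hzt).tendsto.comp hdom
  constructor
  · refine mem_normalCone_of_projected_steps (Y := fun k s => (Y k s).1) (L := L)
      (y := fun s => (z s).1) hne hXclosed hXconvex hXlip ht hpos hΔ ?_
      (fun s hs => (hlim s hs).fst_nhds) ?_ (hprimal.const_smul β) hx'
    · filter_upwards [hlip] with k hk
      have h := LipschitzWith.prod_fst.comp_lipschitzOnWith hk
      rwa [one_mul] at h
    · filter_upwards [hstep] with p hp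
      rw [hp]
      rfl
  · rw [← sub_neg_eq_add]
    refine mem_normalCone_of_projected_steps (C := fun _ => nonnegOrthant m)
      (Y := fun k s => (Y k s).2) (L := L) (y := fun s => (z s).2)
      (fun _ _ => nonempty_nonnegOrthant m) (fun _ _ => isClosed_nonnegOrthant m)
      (fun _ _ => convex_nonnegOrthant m) (hausdorffLipschitzOn_const _ _) ht hpos hΔ ?_
      (fun s hs => (hlim s hs).snd_nhds) ?_ (hdual.const_smul (η * β)).neg hl'
    · filter_upwards [hlip] with k hk
      have h := LipschitzWith.prod_snd.comp_lipschitzOnWith hk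
      rwa [one_mul] at h
    · filter_upwards [hstep] with p hp
      rw [hp]
      rfl

end RegPrimalDual

theorem mainTheorem3 {n m : ℕ}
    (c : EuclideanSpace ℝ (Fin n) → ℝ → ℝ)
    (f : EuclideanSpace ℝ (Fin n) → ℝ → EuclideanSpace ℝ (Fin m))
    (X : ℝ → Set (EuclideanSpace ℝ (Fin n)))
    (S β η ε κ₂ : ℝ) (κ₁ : ℝ≥0) (lprior : EuclideanSpace ℝ (Fin m))
    (z₀ : EuclideanSpace ℝ (Fin n) × EuclideanSpace ℝ (Fin m))
    (hS : 0 < S) (hβ : 0 < β) (hη : 0 < η) (hε : 0 < ε) (hκ₂ : 0 < κ₂)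
    (hlprior : lprior ∈ RegPrimalDual.nonnegOrthant m)
    (hz₀ : z₀ ∈ X 0 ×ˢ RegPrimalDual.nonnegOrthant m)
    (hXconvex : ∀ t ∈ Set.Icc 0 S, Convex ℝ (X t))
    (hXclosed : ∀ t ∈ Set.Icc 0 S, IsClosed (X t))
    (hc : ∀ t ∈ Set.Icc 0 S, ContDiff ℝ 2 (fun x => c x t))
    (hf : ∀ t ∈ Set.Icc 0 S, ContDiff ℝ 2 (fun x => f x t))
    (hXlip : RegPrimalDual.HausdorffLipschitzOn κ₁ X (Set.Icc 0 S))
    (hgrad_cont : ContinuousOn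
      (fun p : EuclideanSpace ℝ (Fin n) × ℝ => RegPrimalDual.gradX c p.1 p.2)
      ((⋃ s ∈ Set.Icc 0 S, X s) ×ˢ Set.Icc 0 S))
    (hgrad_growth : ∀ p ∈ (⋃ s ∈ Set.Icc 0 S, X s) ×ˢ Set.Icc 0 S,
      ‖RegPrimalDual.gradX c p.1 p.2‖ ≤ κ₂ * (1 + ‖p.1‖))
    (hf_cont : ContinuousOn
      (fun p : EuclideanSpace ℝ (Fin n) × ℝ => f p.1 p.2)
      ((⋃ s ∈ Set.Icc 0 S, X s) ×ˢ Set.Icc 0 S))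
    (hjac_cont : ContinuousOn
      (fun p : EuclideanSpace ℝ (Fin n) × ℝ => RegPrimalDual.jacX f p.1 p.2)
      ((⋃ s ∈ Set.Icc 0 S, X s) ×ˢ Set.Icc 0 S))
    (hjac_bdd : ∃ M : ℝ, ∀ p ∈ (⋃ s ∈ Set.Icc 0 S, X s) ×ˢ Set.Icc 0 S,
      ‖RegPrimalDual.jacX f p.1 p.2‖ ≤ M) :
    (∃ (φ : ℕ → ℕ) (z : ℝ → EuclideanSpace ℝ (Fin n) × EuclideanSpace ℝ (Fin m)),
      StrictMono φ ∧
      TendstoUniformlyOn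
        (fun k => RegPrimalDual.trajectory c f X S β η ε lprior z₀ (φ k)) z
        Filter.atTop (Set.Icc 0 S)) ∧
    ∀ (φ : ℕ → ℕ) (z : ℝ → EuclideanSpace ℝ (Fin n) × EuclideanSpace ℝ (Fin m)),
      StrictMono φ →
      (∀ t ∈ Set.Icc 0 S, Filter.Tendsto
        (fun k => RegPrimalDual.trajectory c f X S β η ε lprior z₀ (φ k) t)
        Filter.atTop (𝓝 (z t))) →
      TendstoUniformlyOn
        (fun k => RegPrimalDual.trajectory c f X S β η ε lprior z₀ (φ k)) z
        Filter.atTop (Set.Icc 0 S) ∧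
      (∃ L : ℝ≥0, LipschitzOnWith L z (Set.Icc 0 S)) ∧
      ∀ᵐ t ∂(MeasureTheory.volume.restrict (Set.Icc 0 S)),
        ∃ (x' : EuclideanSpace ℝ (Fin n)) (l' : EuclideanSpace ℝ (Fin m)),
          HasDerivAt (fun s => (z s).1) x' t ∧
          HasDerivAt (fun s => (z s).2) l' t ∧
          -x' - β • RegPrimalDual.primalDir c f (z t).1 (z t).2 t
            ∈ RegPrimalDual.normalCone (X t) (z t).1 ∧
          -l' + (η * β) • RegPrimalDual.dualDir f ε lprior (z t).1 (z t).2 t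
            ∈ RegPrimalDual.normalCone (RegPrimalDual.nonnegOrthant m) (z t).2 := by
  have h0 : (0 : ℝ) ∈ Set.Icc 0 S := ⟨le_rfl, hS.le⟩
  obtain ⟨M, hM⟩ := hjac_bdd
  have hM0 : 0 ≤ M := (norm_nonneg _).trans (hM (z₀.1, 0) ⟨Set.mem_biUnion h0 hz₀.1, h0⟩)
  obtain ⟨K, hK, hfK⟩ := RegPrimalDual.exists_norm_le_of_jacX_bdd hS.le ⟨_, hz₀.1⟩ hXconvex
    hXclosed (fun t ht => (hf t ht).differentiable (by norm_num)) hXlip hf_cont hM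
  obtain ⟨L, hL⟩ := RegPrimalDual.exists_lipschitzOnWith_trajectory (η := η) (ε := ε)
    (lprior := lprior) hS hβ.le hη.le hε.le hκ₂.le hM0 hK hz₀ hXclosed hXlip hgrad_growth hM hfK
  constructor
  · -- The trajectories are only controlled for a positive number of slots, hence the shift by one.
    obtain ⟨φ, z, hφ, hz⟩ := RegPrimalDual.exists_subseq_tendstoUniformlyOn hS.le
      (Y := fun k => RegPrimalDual.trajectory c f X S β η ε lprior z₀ (k + 1))
      (fun k => hL (k + 1) k.succ_pos) (y₀ := z₀) (fun k => by
        have h := RegPrimalDual.trajectory_node c f X β η ε lprior z₀ (S := S) (T := k + 1)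
          (by positivity) 0
        simpa [RegPrimalDual.iterates] using h)
    exact ⟨fun k => φ k + 1, z, fun a b hab => Nat.add_lt_add_right (hφ hab) 1, hz⟩
  · intro φ z hφ hlim
    have hlip : ∀ᶠ k in Filter.atTop, LipschitzOnWith L
        (RegPrimalDual.trajectory c f X S β η ε lprior z₀ (φ k)) (Set.Icc 0 S) := by
      filter_upwards [hφ.tendsto_atTop.eventually (Filter.eventually_gt_atTop 0)] with k hk
        using hL _ hk
    have hzlip := RegPrimalDual.lipschitzOnWith_of_tendsto hlip hlim
    refine ⟨RegPrimalDual.tendstoUniformlyOn_of_equiLipschitz isCompact_Icc hlip hlim,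
      ⟨L, hzlip⟩, ?_⟩
    rw [← MeasureTheory.Measure.restrict_congr_set MeasureTheory.Ioo_ae_eq_Icc,
      MeasureTheory.ae_restrict_iff' measurableSet_Ioo]
    filter_upwards [hzlip.ae_differentiableWithinAt_of_mem
      (μ := MeasureTheory.volume)] with t hdiff ht
    have hd := ((hdiff (Set.Ioo_subset_Icc_self ht)).differentiableAt
      (Icc_mem_nhds ht.1 ht.2)).hasDerivAt
    have hx' : HasDerivAt (fun s => (z s).1) (deriv z t).1 t := by
      simpa using hd.hasFDerivAt.fst.hasDerivAt
    have hl' : HasDerivAt (fun s => (z s).2) (deriv z t).2 t := by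
      simpa using hd.hasFDerivAt.snd.hasDerivAt
    exact ⟨_, _, hx', hl', RegPrimalDual.normalCone_inclusions_of_tendsto hS hz₀ hXconvex hXclosed
      hXlip hgrad_cont hf_cont hjac_cont hφ hlip hlim ht hx' hl'⟩
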